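/- Let $R$ be a prime ring (associative, not necessarily unital; i.e. for $a,b\in R$, $aRb=0$ implies $a=0$ or $b=0$) with center $Z(R)$. Let $Q_s(R)\supseteq R$ be its Martindale symmetric ring of quotients, and let $C$ be the extended centroid of $R$, i.e. the center of $Q_s(R)$, which is a field. For an additive subgroup $A$ of $R$ let $AC\subseteq Q_s(R)$ denote the $C$-subspace spanned by $A$; in particular $RC$ is a subring of $Q_s(R)$. Let $K$ be a noncentral Lie ideal of $R$, i.e. an additive subgroup $K\not\subseteq Z(R)$ with $ar-ra\in K$ for all $a\in K$, $r\in R$. Write $$\mathfrak{C}_{RC}(K)=\{x\in RC : ax=xa\ \ \forall a\in K\},\qquad \mathfrak{C}_{R}(K)=\{x\in R : ax=xa\ \ \forall a\in K\}.$$ Then the following hold: (i) $\mathfrak{C}_{RC}(K)=KC$ if and only if $\dim_C KC=2$; (ii) $\mathfrak{C}_{R}(K)=Z(R)$ if and only if $\dim_C KC>2$ (where $\dim_C KC$ may be infinite). -/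

import Mathlib

universe u

/-- A prime ring (associative, not necessarily unital): a nonzero ring in which `a R b = 0` forces
`a = 0` or `b = 0`. -/
class IsPrimeRing (R : Type u) [NonUnitalRing R] : Prop extends Nontrivial R where
  eq_zero_or_eq_zero : ∀ a b : R, (∀ r : R, a * r * b = 0) → a = 0 ∨ b = 0

/-- A Lie ideal of an associative ring: an additive subgroup `L` with `[L, R] ⊆ L`. -/
def IsLieIdeal {R : Type u} [NonUnitalRing R] (L : AddSubgroup R) : Prop :=
  ∀ a ∈ L, ∀ r : R, a * r - r * a ∈ L

namespace MartindaleSymm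

/-- Representatives of elements of the Martindale symmetric ring of quotients of `R`: a nonzero
two-sided ideal `I` of `R` with a right `R`-module map `I → R`, `x ↦ lmap x` (to be thought of as
`x ↦ q x`), and a left `R`-module map `I → R`, `x ↦ rmap x` (to be thought of as `x ↦ x q`), such
that `(x q) y = x (q y)` for `x, y ∈ I`. For convenience `lmap` and `rmap` are total functions, but
only their values on `I` are relevant, see `QRep.Rel`. -/
structure QRep (R : Type u) [NonUnitalRing R] where
  dom : TwoSidedIdeal R
  dom_ne_bot : dom ≠ ⊥
  lmap : R → R
  rmap : R → R
  lmap_add : ∀ x ∈ dom, ∀ y ∈ dom, lmap (x + y) = lmap x + lmap y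
  rmap_add : ∀ x ∈ dom, ∀ y ∈ dom, rmap (x + y) = rmap x + rmap y
  lmap_mul : ∀ x ∈ dom, ∀ s : R, lmap (x * s) = lmap x * s
  rmap_mul : ∀ x ∈ dom, ∀ s : R, rmap (s * x) = s * rmap x
  compat : ∀ x ∈ dom, ∀ y ∈ dom, rmap x * y = x * lmap y

variable {R : Type u} [NonUnitalRing R]

namespace QRep

/-- Two representatives are identified when they agree on a nonzero ideal contained in both
domains. -/
def Rel (p q : QRep R) : Prop :=
  ∃ J : TwoSidedIdeal R, J ≠ ⊥ ∧ J ≤ p.dom ∧ J ≤ q.dom ∧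
    ∀ x ∈ J, p.lmap x = q.lmap x ∧ p.rmap x = q.rmap x

theorem rel_refl (p : QRep R) : Rel p p :=
  ⟨p.dom, p.dom_ne_bot, le_rfl, le_rfl, fun _ _ => ⟨rfl, rfl⟩⟩

theorem rel_symm {p q : QRep R} : Rel p q → Rel q p := fun ⟨J, h0, h1, h2, h⟩ =>
  ⟨J, h0, h2, h1, fun x hx => ⟨(h x hx).1.symm, (h x hx).2.symm⟩⟩

theorem lmap_zero (p : QRep R) : p.lmap 0 = 0 := by
  simpa using p.lmap_add 0 p.dom.zero_mem 0 p.dom.zero_mem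

theorem rmap_zero (p : QRep R) : p.rmap 0 = 0 := by
  simpa using p.rmap_add 0 p.dom.zero_mem 0 p.dom.zero_mem

theorem lmap_neg (p : QRep R) {x : R} (hx : x ∈ p.dom) : p.lmap (-x) = -p.lmap x := by
  have h := p.lmap_add x hx (-x) (p.dom.neg_mem hx)
  rw [add_neg_cancel, p.lmap_zero] at h
  exact (neg_eq_of_add_eq_zero_right h.symm).symm

theorem rmap_neg (p : QRep R) {x : R} (hx : x ∈ p.dom) : p.rmap (-x) = -p.rmap x := by
  have h := p.rmap_add x hx (-x) (p.dom.neg_mem hx)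
  rw [add_neg_cancel, p.rmap_zero] at h
  exact (neg_eq_of_add_eq_zero_right h.symm).symm

/-- For ideals `I` and `J` in the domains of `p` and `q`, an ideal of elements
`x ∈ I ∩ J` with `q x ∈ I` and `x p ∈ J`; it contains all products `x y` with `x, y ∈ I ∩ J`. -/
def mulDom (p q : QRep R) (I J : TwoSidedIdeal R) (hI : I ≤ p.dom) (hJ : J ≤ q.dom) :
    TwoSidedIdeal R :=
  .mk' {x | (x ∈ I ∧ x ∈ J) ∧ (q.lmap x ∈ I ∧ ∀ s, q.lmap (s * x) ∈ I) ∧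
      (p.rmap x ∈ J ∧ ∀ s, p.rmap (x * s) ∈ J)}
    (by
      simp only [Set.mem_ofPred_eq, mul_zero, zero_mul, q.lmap_zero, p.rmap_zero]
      simp [I.zero_mem, J.zero_mem])
    (by
      rintro x y ⟨⟨h1, h2⟩, ⟨h3, h4⟩, h5, h6⟩ ⟨⟨k1, k2⟩, ⟨k3, k4⟩, k5, k6⟩
      refine ⟨⟨I.add_mem h1 k1, J.add_mem h2 k2⟩, ⟨?_, fun s => ?_⟩, ?_, fun s => ?_⟩
      · rw [q.lmap_add x (hJ h2) y (hJ k2)]; exact I.add_mem h3 k3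
      · rw [mul_add, q.lmap_add _ (hJ (J.mul_mem_left s x h2)) _ (hJ (J.mul_mem_left s y k2))]
        exact I.add_mem (h4 s) (k4 s)
      · rw [p.rmap_add x (hI h1) y (hI k1)]; exact J.add_mem h5 k5
      · rw [add_mul, p.rmap_add _ (hI (I.mul_mem_right x s h1)) _ (hI (I.mul_mem_right y s k1))]
        exact J.add_mem (h6 s) (k6 s))
    (by
      rintro x ⟨⟨h1, h2⟩, ⟨h3, h4⟩, h5, h6⟩
      refine ⟨⟨I.neg_mem h1, J.neg_mem h2⟩, ⟨?_, fun s => ?_⟩, ?_, fun s => ?_⟩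
      · rw [q.lmap_neg (hJ h2)]; exact I.neg_mem h3
      · rw [mul_neg, q.lmap_neg (hJ (J.mul_mem_left s x h2))]; exact I.neg_mem (h4 s)
      · rw [p.rmap_neg (hI h1)]; exact J.neg_mem h5
      · rw [neg_mul, p.rmap_neg (hI (I.mul_mem_right x s h1))]; exact J.neg_mem (h6 s))
    (by
      rintro u x ⟨⟨h1, h2⟩, ⟨h3, h4⟩, h5, h6⟩
      refine ⟨⟨I.mul_mem_left _ _ h1, J.mul_mem_left _ _ h2⟩, ⟨h4 u, fun s => ?_⟩, ?_,
        fun s => ?_⟩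
      · rw [← mul_assoc]; exact h4 _
      · rw [p.rmap_mul x (hI h1)]; exact J.mul_mem_left _ _ h5
      · rw [mul_assoc, p.rmap_mul _ (hI (I.mul_mem_right x s h1))]
        exact J.mul_mem_left _ _ (h6 s))
    (by
      rintro x u ⟨⟨h1, h2⟩, ⟨h3, h4⟩, h5, h6⟩
      refine ⟨⟨I.mul_mem_right _ _ h1, J.mul_mem_right _ _ h2⟩, ⟨?_, fun s => ?_⟩, h6 u,
        fun s => ?_⟩
      · rw [q.lmap_mul x (hJ h2)]; exact I.mul_mem_right _ _ h3
      · rw [← mul_assoc, q.lmap_mul _ (hJ (J.mul_mem_left s x h2))]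
        exact I.mul_mem_right _ _ (h4 s)
      · rw [mul_assoc]; exact h6 _)

theorem mem_mulDom {p q : QRep R} {I J : TwoSidedIdeal R} {hI : I ≤ p.dom} {hJ : J ≤ q.dom}
    {x : R} : x ∈ mulDom p q I J hI hJ ↔ (x ∈ I ∧ x ∈ J) ∧
      (q.lmap x ∈ I ∧ ∀ s, q.lmap (s * x) ∈ I) ∧ (p.rmap x ∈ J ∧ ∀ s, p.rmap (x * s) ∈ J) := by
  rw [mulDom, TwoSidedIdeal.mem_mk']; rfl

end QRep

theorem exists_mem_ne_zero {I : TwoSidedIdeal R} (hI : I ≠ ⊥) : ∃ x ∈ I, x ≠ 0 := by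
  by_contra! h
  exact hI (le_bot_iff.mp fun x hx => (TwoSidedIdeal.mem_bot R).mpr (h x hx))

theorem ne_bot_of_mem {I : TwoSidedIdeal R} {x : R} (hx : x ∈ I) (h0 : x ≠ 0) : I ≠ ⊥ := by
  rintro rfl
  exact h0 ((TwoSidedIdeal.mem_bot R).mp hx)

variable [IsPrimeRing R]

theorem exists_mul_mul_ne_zero {a b : R} (ha : a ≠ 0) (hb : b ≠ 0) : ∃ r : R, a * r * b ≠ 0 := by
  by_contra! h
  exact (IsPrimeRing.eq_zero_or_eq_zero a b h).elim ha hb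

theorem inf_ne_bot {I J : TwoSidedIdeal R} (hI : I ≠ ⊥) (hJ : J ≠ ⊥) : I ⊓ J ≠ ⊥ := by
  obtain ⟨a, ha, ha0⟩ := exists_mem_ne_zero hI
  obtain ⟨b, hb, hb0⟩ := exists_mem_ne_zero hJ
  obtain ⟨r, hr⟩ := exists_mul_mul_ne_zero ha0 hb0
  exact ne_bot_of_mem (x := a * r * b) ((TwoSidedIdeal.mem_inf R).mpr
    ⟨I.mul_mem_right _ _ (I.mul_mem_right _ _ ha), J.mul_mem_left _ _ hb⟩) hr

theorem top_ne_bot' : (⊤ : TwoSidedIdeal R) ≠ ⊥ := by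
  obtain ⟨x, hx⟩ := exists_ne (0 : R)
  exact ne_bot_of_mem (x := x) (TwoSidedIdeal.mem_top R) hx

namespace QRep

theorem rel_trans {p q s : QRep R} : Rel p q → Rel q s → Rel p s :=
  fun ⟨J, h0, h1, _, h⟩ ⟨J', h0', _, h2', h'⟩ =>
  ⟨J ⊓ J', inf_ne_bot h0 h0', inf_le_left.trans h1, inf_le_right.trans h2', fun x hx =>
    ⟨(h x (inf_le_left (a := J) hx)).1.trans (h' x (inf_le_right (a := J) hx)).1,
      (h x (inf_le_left (a := J) hx)).2.trans (h' x (inf_le_right (a := J) hx)).2⟩⟩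

instance setoid (R : Type u) [NonUnitalRing R] [IsPrimeRing R] : Setoid (QRep R) :=
  ⟨Rel, rel_refl, rel_symm, rel_trans⟩

/-- Equality of the maps on the intersection of the domains suffices. -/
theorem rel_of_eq {p q : QRep R} (h : ∀ x ∈ p.dom, x ∈ q.dom →
    p.lmap x = q.lmap x ∧ p.rmap x = q.rmap x) : p ≈ q :=
  ⟨p.dom ⊓ q.dom, inf_ne_bot p.dom_ne_bot q.dom_ne_bot, inf_le_left, inf_le_right,
    fun x hx => h x (inf_le_left (a := p.dom) hx) (inf_le_right (a := p.dom) hx)⟩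

/-- The class of an element `a` of `R`: the maps `x ↦ a x` and `x ↦ x a` on `R`. -/
def of (a : R) : QRep R where
  dom := ⊤
  dom_ne_bot := top_ne_bot'
  lmap x := a * x
  rmap x := x * a
  lmap_add x _ y _ := mul_add a x y
  rmap_add x _ y _ := add_mul x y a
  lmap_mul x _ s := (mul_assoc a x s).symm
  rmap_mul x _ s := mul_assoc s x a
  compat x _ y _ := mul_assoc x a y

/-- The unit element: the identity maps on `R`. -/
def one (R : Type u) [NonUnitalRing R] [IsPrimeRing R] : QRep R where
  dom := ⊤
  dom_ne_bot := top_ne_bot'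
  lmap x := x
  rmap x := x
  lmap_add _ _ _ _ := rfl
  rmap_add _ _ _ _ := rfl
  lmap_mul _ _ _ := rfl
  rmap_mul _ _ _ := rfl
  compat _ _ _ _ := rfl

/-- Addition of the maps, on the intersection of the domains. -/
def add (p q : QRep R) : QRep R where
  dom := p.dom ⊓ q.dom
  dom_ne_bot := inf_ne_bot p.dom_ne_bot q.dom_ne_bot
  lmap x := p.lmap x + q.lmap x
  rmap x := p.rmap x + q.rmap x
  lmap_add x hx y hy := by
    rw [TwoSidedIdeal.mem_inf] at hx hy
    rw [p.lmap_add x hx.1 y hy.1, q.lmap_add x hx.2 y hy.2, add_add_add_comm]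
  rmap_add x hx y hy := by
    rw [TwoSidedIdeal.mem_inf] at hx hy
    rw [p.rmap_add x hx.1 y hy.1, q.rmap_add x hx.2 y hy.2, add_add_add_comm]
  lmap_mul x hx s := by
    rw [TwoSidedIdeal.mem_inf] at hx
    rw [p.lmap_mul x hx.1, q.lmap_mul x hx.2, add_mul]
  rmap_mul x hx s := by
    rw [TwoSidedIdeal.mem_inf] at hx
    rw [p.rmap_mul x hx.1, q.rmap_mul x hx.2, mul_add]
  compat x hx y hy := by
    rw [TwoSidedIdeal.mem_inf] at hx hy
    rw [add_mul, mul_add, p.compat x hx.1 y hy.1, q.compat x hx.2 y hy.2]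

/-- Negation of the maps. -/
def neg (p : QRep R) : QRep R where
  dom := p.dom
  dom_ne_bot := p.dom_ne_bot
  lmap x := -p.lmap x
  rmap x := -p.rmap x
  lmap_add x hx y hy := by rw [p.lmap_add x hx y hy, neg_add]
  rmap_add x hx y hy := by rw [p.rmap_add x hx y hy, neg_add]
  lmap_mul x hx s := by rw [p.lmap_mul x hx, neg_mul]
  rmap_mul x hx s := by rw [p.rmap_mul x hx, mul_neg]
  compat x hx y hy := by rw [neg_mul, mul_neg, p.compat x hx y hy]

theorem mulDom_ne_bot (p q : QRep R) (I J : TwoSidedIdeal R) (hI : I ≤ p.dom) (hJ : J ≤ q.dom)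
    (hI0 : I ≠ ⊥) (hJ0 : J ≠ ⊥) : mulDom p q I J hI hJ ≠ ⊥ := by
  obtain ⟨x, hx, hx0⟩ := exists_mem_ne_zero (inf_ne_bot hI0 hJ0)
  rw [TwoSidedIdeal.mem_inf] at hx
  obtain ⟨r, hr⟩ := exists_mul_mul_ne_zero hx0 hx0
  have hxr : x * r ∈ I ∧ x * r ∈ J := ⟨I.mul_mem_right _ _ hx.1, J.mul_mem_right _ _ hx.2⟩
  refine ne_bot_of_mem (x := x * r * x) (mem_mulDom.mpr
    ⟨⟨I.mul_mem_left _ _ hx.1, J.mul_mem_left _ _ hx.2⟩, ⟨?_, fun s => ?_⟩, ?_, fun s => ?_⟩) hr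
  · rw [q.lmap_mul _ (hJ hxr.2)]; exact I.mul_mem_left _ _ hx.1
  · rw [← mul_assoc, q.lmap_mul _ (hJ (J.mul_mem_left _ _ hxr.2))]
    exact I.mul_mem_left _ _ hx.1
  · rw [p.rmap_mul _ (hI hx.1)]; exact J.mul_mem_right _ _ hxr.2
  · rw [mul_assoc, p.rmap_mul _ (hI (I.mul_mem_right _ _ hx.1))]
    exact J.mul_mem_right _ _ hxr.2

/-- Multiplication: `(p q) x = p (q x)` and `x (p q) = (x p) q`. -/
def mul (p q : QRep R) : QRep R where
  dom := mulDom p q p.dom q.dom le_rfl le_rfl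
  dom_ne_bot := mulDom_ne_bot _ _ _ _ _ _ p.dom_ne_bot q.dom_ne_bot
  lmap x := p.lmap (q.lmap x)
  rmap x := q.rmap (p.rmap x)
  lmap_add x hx y hy := by
    obtain ⟨⟨h1, h2⟩, ⟨h3, h4⟩, h5, h6⟩ := mem_mulDom.mp hx
    obtain ⟨⟨k1, k2⟩, ⟨k3, k4⟩, k5, k6⟩ := mem_mulDom.mp hy
    rw [q.lmap_add x h2 y k2, p.lmap_add _ h3 _ k3]
  rmap_add x hx y hy := by
    obtain ⟨⟨h1, h2⟩, ⟨h3, h4⟩, h5, h6⟩ := mem_mulDom.mp hx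
    obtain ⟨⟨k1, k2⟩, ⟨k3, k4⟩, k5, k6⟩ := mem_mulDom.mp hy
    rw [p.rmap_add x h1 y k1, q.rmap_add _ h5 _ k5]
  lmap_mul x hx s := by
    obtain ⟨⟨h1, h2⟩, ⟨h3, h4⟩, h5, h6⟩ := mem_mulDom.mp hx
    rw [q.lmap_mul x h2, p.lmap_mul _ h3]
  rmap_mul x hx s := by
    obtain ⟨⟨h1, h2⟩, ⟨h3, h4⟩, h5, h6⟩ := mem_mulDom.mp hx
    rw [p.rmap_mul x h1, q.rmap_mul _ h5]
  compat x hx y hy := by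
    obtain ⟨⟨h1, h2⟩, ⟨h3, h4⟩, h5, h6⟩ := mem_mulDom.mp hx
    obtain ⟨⟨k1, k2⟩, ⟨k3, k4⟩, k5, k6⟩ := mem_mulDom.mp hy
    rw [q.compat _ h5 y k2, p.compat x h1 _ k3]

theorem add_congr {p p' q q' : QRep R} (hp : p ≈ p') (hq : q ≈ q') : add p q ≈ add p' q' := by
  obtain ⟨J, h0, h1, h2, h⟩ := hp
  obtain ⟨J', h0', h1', h2', h'⟩ := hq
  refine ⟨J ⊓ J', inf_ne_bot h0 h0', inf_le_inf h1 h1', inf_le_inf h2 h2', fun x hx => ?_⟩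
  rw [TwoSidedIdeal.mem_inf] at hx
  exact ⟨congrArg₂ (· + ·) (h x hx.1).1 (h' x hx.2).1,
    congrArg₂ (· + ·) (h x hx.1).2 (h' x hx.2).2⟩

theorem neg_congr {p p' : QRep R} (hp : p ≈ p') : neg p ≈ neg p' := by
  obtain ⟨J, h0, h1, h2, h⟩ := hp
  exact ⟨J, h0, h1, h2, fun x hx => ⟨congrArg _ (h x hx).1, congrArg _ (h x hx).2⟩⟩

theorem mul_congr {p p' q q' : QRep R} (hp : p ≈ p') (hq : q ≈ q') : mul p q ≈ mul p' q' := by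
  obtain ⟨J, h0, h1, h2, h⟩ := hp
  obtain ⟨J', h0', h1', h2', h'⟩ := hq
  refine ⟨mulDom p q J J' h1 h1', mulDom_ne_bot _ _ _ _ _ _ h0 h0', fun x hx => ?_,
    fun x hx => ?_, fun x hx => ?_⟩
  · obtain ⟨⟨a1, a2⟩, ⟨a3, a4⟩, a5, a6⟩ := mem_mulDom.mp hx
    exact (mem_mulDom (hI := le_rfl) (hJ := le_rfl)).mpr ⟨⟨h1 a1, h1' a2⟩, ⟨h1 a3, fun s => h1 (a4 s)⟩, h1' a5,
      fun s => h1' (a6 s)⟩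
  · obtain ⟨⟨a1, a2⟩, ⟨a3, a4⟩, a5, a6⟩ := mem_mulDom.mp hx
    refine (mem_mulDom (hI := le_rfl) (hJ := le_rfl)).mpr ⟨⟨h2 a1, h2' a2⟩, ⟨?_, fun s => ?_⟩, ?_, fun s => ?_⟩
    · rw [← (h' x a2).1]; exact h2 a3
    · rw [← (h' _ (J'.mul_mem_left s x a2)).1]; exact h2 (a4 s)
    · rw [← (h x a1).2]; exact h2' a5
    · rw [← (h _ (J.mul_mem_right x s a1)).2]; exact h2' (a6 s)
  · obtain ⟨⟨a1, a2⟩, ⟨a3, a4⟩, a5, a6⟩ := mem_mulDom.mp hx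
    change p.lmap (q.lmap x) = p'.lmap (q'.lmap x) ∧ q.rmap (p.rmap x) = q'.rmap (p'.rmap x)
    rw [← (h' x a2).1, ← (h x a1).2]
    exact ⟨(h _ a3).1, (h' _ a5).2⟩

end QRep

end MartindaleSymm

open MartindaleSymm in
/-- The Martindale symmetric ring of quotients `Q_s(R)` of a prime ring `R`. -/
def MartindaleQuotient (R : Type u) [NonUnitalRing R] [IsPrimeRing R] : Type u :=
  Quotient (QRep.setoid R)

namespace MartindaleQuotient

open MartindaleSymm

variable {R : Type u} [NonUnitalRing R] [IsPrimeRing R]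

/-- The class of a representative. -/
def mk (p : QRep R) : MartindaleQuotient R := Quotient.mk _ p

instance : Zero (MartindaleQuotient R) := ⟨mk (QRep.of 0)⟩
instance : One (MartindaleQuotient R) := ⟨mk (QRep.one R)⟩
instance : Add (MartindaleQuotient R) :=
  ⟨Quotient.map₂ QRep.add fun _ _ hp _ _ hq => QRep.add_congr hp hq⟩
instance : Neg (MartindaleQuotient R) := ⟨Quotient.map QRep.neg fun _ _ hp => QRep.neg_congr hp⟩
instance : Mul (MartindaleQuotient R) :=
  ⟨Quotient.map₂ QRep.mul fun _ _ hp _ _ hq => QRep.mul_congr hp hq⟩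

instance : Ring (MartindaleQuotient R) where
  add_assoc := by
    rintro ⟨a⟩ ⟨b⟩ ⟨c⟩
    exact Quotient.sound (QRep.rel_of_eq fun x _ _ => ⟨add_assoc _ _ _, add_assoc _ _ _⟩)
  zero_add := by
    rintro ⟨a⟩
    refine Quotient.sound (QRep.rel_of_eq fun x _ _ => ⟨?_, ?_⟩)
    · change 0 * x + a.lmap x = _; rw [zero_mul, zero_add]
    · change x * 0 + a.rmap x = _; rw [mul_zero, zero_add]
  add_zero := by
    rintro ⟨a⟩
    refine Quotient.sound (QRep.rel_of_eq fun x _ _ => ⟨?_, ?_⟩)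
    · change a.lmap x + 0 * x = _; rw [zero_mul, add_zero]
    · change a.rmap x + x * 0 = _; rw [mul_zero, add_zero]
  add_comm := by
    rintro ⟨a⟩ ⟨b⟩
    exact Quotient.sound (QRep.rel_of_eq fun x _ _ => ⟨add_comm _ _, add_comm _ _⟩)
  neg_add_cancel := by
    rintro ⟨a⟩
    refine Quotient.sound (QRep.rel_of_eq fun x _ _ => ⟨?_, ?_⟩)
    · change -a.lmap x + a.lmap x = 0 * x; rw [zero_mul, neg_add_cancel]
    · change -a.rmap x + a.rmap x = x * 0; rw [mul_zero, neg_add_cancel]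
  mul_assoc := by
    rintro ⟨a⟩ ⟨b⟩ ⟨c⟩
    exact Quotient.sound (QRep.rel_of_eq fun x _ _ => ⟨rfl, rfl⟩)
  one_mul := by
    rintro ⟨a⟩
    exact Quotient.sound (QRep.rel_of_eq fun x _ _ => ⟨rfl, rfl⟩)
  mul_one := by
    rintro ⟨a⟩
    exact Quotient.sound (QRep.rel_of_eq fun x _ _ => ⟨rfl, rfl⟩)
  zero_mul := by
    rintro ⟨a⟩
    refine Quotient.sound (QRep.rel_of_eq fun x _ _ => ⟨?_, ?_⟩)
    · change 0 * a.lmap x = 0 * x; rw [zero_mul, zero_mul]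
    · change a.rmap (x * 0) = x * 0; rw [mul_zero, a.rmap_zero]
  mul_zero := by
    rintro ⟨a⟩
    refine Quotient.sound (QRep.rel_of_eq fun x _ _ => ⟨?_, ?_⟩)
    · change a.lmap (0 * x) = 0 * x; rw [zero_mul, a.lmap_zero]
    · change a.rmap x * 0 = x * 0; rw [mul_zero, mul_zero]
  left_distrib := by
    rintro ⟨a⟩ ⟨b⟩ ⟨c⟩
    refine Quotient.sound (QRep.rel_of_eq fun x _ hx => ⟨?_, rfl⟩)
    obtain ⟨h, h'⟩ := (TwoSidedIdeal.mem_inf R).mp hx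
    exact a.lmap_add _ ((QRep.mem_mulDom (hI := le_rfl) (hJ := le_rfl)).mp h).2.1.1 _ ((QRep.mem_mulDom (hI := le_rfl) (hJ := le_rfl)).mp h').2.1.1
  right_distrib := by
    rintro ⟨a⟩ ⟨b⟩ ⟨c⟩
    refine Quotient.sound (QRep.rel_of_eq fun x _ hx => ⟨rfl, ?_⟩)
    obtain ⟨h, h'⟩ := (TwoSidedIdeal.mem_inf R).mp hx
    exact c.rmap_add _ ((QRep.mem_mulDom (hI := le_rfl) (hJ := le_rfl)).mp h).2.2.1 _ ((QRep.mem_mulDom (hI := le_rfl) (hJ := le_rfl)).mp h').2.2.1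
  nsmul := nsmulRec
  zsmul := zsmulRec

/-- The canonical embedding `R → Q_s(R)`. -/
def of (R : Type u) [NonUnitalRing R] [IsPrimeRing R] : R →ₙ+* MartindaleQuotient R where
  toFun a := mk (QRep.of a)
  map_zero' := rfl
  map_add' a b :=
    Quotient.sound (QRep.rel_of_eq fun x _ _ => ⟨add_mul a b x, mul_add x a b⟩)
  map_mul' a b :=
    Quotient.sound (QRep.rel_of_eq fun x _ _ => ⟨mul_assoc a b x, (mul_assoc x a b).symm⟩)

end MartindaleQuotient

/-- The extended centroid `C` of a prime ring `R`: the center of `Q_s(R)`. -/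
abbrev ExtendedCentroid (R : Type u) [NonUnitalRing R] [IsPrimeRing R] :
    Subring (MartindaleQuotient R) :=
  Subring.center (MartindaleQuotient R)

/-- For a subset `A` of `R`, the `C`-subspace `AC` of `Q_s(R)`: all finite sums of products `a c`
with `a` in the additive subgroup generated by `A` and `c ∈ C`. -/
def mulExtendedCentroid {R : Type u} [NonUnitalRing R] [IsPrimeRing R] (A : Set R) :
    Submodule (ExtendedCentroid R) (MartindaleQuotient R) :=
  Submodule.span (ExtendedCentroid R) (MartindaleQuotient.of R '' A)

/-! ### The quotient ring `Q_s(R)`, its primeness, and Martindale's lemma. -/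

namespace MartindaleQuotient

open MartindaleSymm

variable {R : Type u} [NonUnitalRing R] [IsPrimeRing R]

/-! Write [x, y] = xy - yx. Two facts carry the proof.

If [x, [y, r]] = 0 for all r in R and x is not central, then y lies in Cx + C (`exists_eq_smul_add`,
by Martindale's lemma). For a Lie ideal K this applies in two ways: a noncentral x in R centralizing
K forces KC into Cx + C, so dim KC ≤ 2; and for a noncentral a in K, everything that centralizes K
lies in Ca + C.

If every [a, r] lies in Ca, then a is central (`commute_of_forall_lie_mem_span`). Hence a noncentral
K has dim KC ≥ 2. When dim KC = 2 with basis a, b in K, the same fact applied to [a, b] shows that K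
is commutative. An element b of K independent of a then has the form ca + d with d ≠ 0, so 1 lies in
KC and KC contains Ca + C.

Both equivalences follow: K is commutative exactly when dim KC = 2, and when dim KC > 2 no
noncentral element of R centralizes K. -/

theorem mk_mul_of (p : QRep R) {x : R} (hx : x ∈ p.dom) : mk p * of R x = of R (p.lmap x) :=
  Quotient.sound <| QRep.rel_of_eq fun y hy _ =>
    ⟨p.lmap_mul x hx y, p.compat y ((QRep.mem_mulDom (hI := le_rfl) (hJ := le_rfl)).mp hy).1.1 x hx⟩

theorem of_mul_mk (p : QRep R) {x : R} (hx : x ∈ p.dom) : of R x * mk p = of R (p.rmap x) :=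
  Quotient.sound <| QRep.rel_of_eq fun y hy _ =>
    ⟨(p.compat x hx y ((QRep.mem_mulDom (hI := le_rfl) (hJ := le_rfl)).mp hy).1.2).symm,
      p.rmap_mul x hx y⟩

theorem eq_zero_of_forall_mem_mul {J : TwoSidedIdeal R} (hJ : J ≠ ⊥) {a : R}
    (h : ∀ x ∈ J, a * x = 0) : a = 0 := by
  obtain ⟨x, hx, hx0⟩ := exists_mem_ne_zero hJ
  exact (IsPrimeRing.eq_zero_or_eq_zero a x fun r => by
    rw [mul_assoc]; exact h _ (J.mul_mem_left _ _ hx)).resolve_right hx0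

theorem eq_zero_of_forall_mul_mem {J : TwoSidedIdeal R} (hJ : J ≠ ⊥) {a : R}
    (h : ∀ x ∈ J, x * a = 0) : a = 0 := by
  obtain ⟨x, hx, hx0⟩ := exists_mem_ne_zero hJ
  exact (IsPrimeRing.eq_zero_or_eq_zero x a fun r =>
    h _ (J.mul_mem_right _ _ hx)).resolve_left hx0

theorem of_injective : Function.Injective (of R) := by
  refine (injective_iff_map_eq_zero _).mpr fun a ha => ?_
  obtain ⟨J, hJ, -, -, h⟩ := Quotient.exact (ha : mk (QRep.of a) = mk (QRep.of 0))
  exact eq_zero_of_forall_mem_mul hJ fun x hx => (h x hx).1.trans (zero_mul x)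

/-- Every element of the quotient ring maps a nonzero ideal of `R` into `R`, from both sides. -/
theorem exists_ideal (q : MartindaleQuotient R) : ∃ I : TwoSidedIdeal R, I ≠ ⊥ ∧
    ∀ x ∈ I, (∃ y, q * of R x = of R y) ∧ ∃ y, of R x * q = of R y := by
  obtain ⟨p, rfl⟩ := Quotient.exists_rep q
  exact ⟨p.dom, p.dom_ne_bot, fun x hx => ⟨⟨_, mk_mul_of p hx⟩, ⟨_, of_mul_mk p hx⟩⟩⟩

theorem eq_zero_of_mul_of {I : TwoSidedIdeal R} (hI : I ≠ ⊥) {q : MartindaleQuotient R}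
    (h : ∀ x ∈ I, q * of R x = 0) : q = 0 := by
  obtain ⟨p, rfl⟩ := Quotient.exists_rep q
  have hJ := inf_ne_bot hI p.dom_ne_bot
  have hl : ∀ x ∈ I ⊓ p.dom, p.lmap x = 0 := fun x hx => by
    rw [TwoSidedIdeal.mem_inf] at hx
    apply of_injective
    rw [← mk_mul_of p hx.2, map_zero]
    exact h x hx.1
  refine Quotient.sound ⟨I ⊓ p.dom, hJ, inf_le_right, le_top, fun x hx => ⟨?_, ?_⟩⟩
  · exact (hl x hx).trans (zero_mul x).symm
  -- The right-hand map also vanishes, since (xq)y = x(qy) = 0 for all y in a nonzero ideal.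
  · refine Eq.trans (eq_zero_of_forall_mem_mul hJ fun y hy => ?_) (mul_zero x).symm
    rw [p.compat x ((TwoSidedIdeal.mem_inf R).mp hx).2 y ((TwoSidedIdeal.mem_inf R).mp hy).2,
      hl y hy, mul_zero]

theorem eq_zero_of_of_mul {I : TwoSidedIdeal R} (hI : I ≠ ⊥) {q : MartindaleQuotient R}
    (h : ∀ x ∈ I, of R x * q = 0) : q = 0 := by
  obtain ⟨J, hJ, hq⟩ := exists_ideal q
  refine eq_zero_of_mul_of hJ fun y hy => ?_
  obtain ⟨z, hz⟩ := (hq y hy).1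
  rw [hz, eq_zero_of_forall_mul_mem hI (a := z), map_zero]
  intro x hx
  apply of_injective
  rw [map_mul, ← hz, ← mul_assoc, h x hx, zero_mul, map_zero]

/-- Primeness of the quotient ring, with the middle factor in `R`. -/
theorem eq_zero_or_eq_zero {p q : MartindaleQuotient R} (h : ∀ s, p * of R s * q = 0) :
    p = 0 ∨ q = 0 := by
  by_contra! hpq
  obtain ⟨I, hI, hp⟩ := exists_ideal p
  obtain ⟨J, hJ, hq⟩ := exists_ideal q
  obtain ⟨x, hx, hxp⟩ : ∃ x ∈ I, of R x * p ≠ 0 := by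
    by_contra! hh; exact hpq.1 (eq_zero_of_of_mul hI hh)
  obtain ⟨y, hy, hyq⟩ : ∃ y ∈ J, q * of R y ≠ 0 := by
    by_contra! hh; exact hpq.2 (eq_zero_of_mul_of hJ hh)
  obtain ⟨x', hx'⟩ := (hp x hx).2
  obtain ⟨y', hy'⟩ := (hq y hy).1
  rw [hx'] at hxp
  rw [hy'] at hyq
  refine (IsPrimeRing.eq_zero_or_eq_zero x' y' fun s => of_injective ?_).elim
    (fun h0 => hxp (by rw [h0, map_zero])) (fun h0 => hyq (by rw [h0, map_zero]))
  calc of R (x' * s * y') = of R x * (p * of R s * q) * of R y := by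
        rw [map_mul, map_mul, ← hx', ← hy']; simp only [mul_assoc]
    _ = of R 0 := by rw [h, mul_zero, zero_mul, map_zero]

/-- Any t in the quotient ring carries a nonzero ideal into R, and q commutes both with that ideal
and with its image. -/
theorem mem_center_of_commute {q : MartindaleQuotient R} (h : ∀ r, q * of R r = of R r * q) :
    q ∈ ExtendedCentroid R := by
  refine Subring.mem_center_iff.mpr fun t => sub_eq_zero.mp ?_
  obtain ⟨I, hI, ht⟩ := exists_ideal t
  refine eq_zero_of_mul_of hI fun x hx => ?_
  obtain ⟨y, hy⟩ := (ht x hx).1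
  rw [sub_mul, mul_assoc, mul_assoc, h, hy, ← mul_assoc, hy, h, sub_self]

/-- Bimodule maps from a nonzero ideal to `R` are given by elements of the extended centroid. -/
theorem exists_extendedCentroid (J : TwoSidedIdeal R) (hJ : J ≠ ⊥) (f : R → R)
    (hadd : ∀ x ∈ J, ∀ y ∈ J, f (x + y) = f x + f y)
    (hr : ∀ x ∈ J, ∀ s, f (x * s) = f x * s) (hl : ∀ x ∈ J, ∀ s, f (s * x) = s * f x) :
    ∃ c : ExtendedCentroid R, ∀ x ∈ J, (c : MartindaleQuotient R) * of R x = of R (f x) := by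
  -- One map serves on both sides: f(x)y = f(xy) = xf(y).
  let p : QRep R := ⟨J, hJ, f, f, hadd, hadd, hr, hl, fun x hx y hy => by
    rw [← hr x hx, ← hl y hy]⟩
  refine ⟨⟨mk p, mem_center_of_commute fun r => sub_eq_zero.mp
    (eq_zero_of_mul_of hJ fun x hx => ?_)⟩, fun x hx => mk_mul_of p hx⟩
  rw [sub_mul, mul_assoc, mul_assoc, mk_mul_of p hx, ← map_mul, ← map_mul,
    mk_mul_of p (J.mul_mem_left _ _ hx), ← map_sub]
  change of R (f (r * x) - r * f x) = 0
  rw [hl x hx, sub_self, map_zero]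

/-- Martindale's lemma. -/
theorem exists_eq_mul {p q q' : MartindaleQuotient R} (hp : p ≠ 0)
    (h : ∀ s, p * of R s * q' = q * of R s * p) :
    ∃ c : ExtendedCentroid R, q = c * p := by
  -- The z attached to w is unique by primeness, and w ↦ z is a bimodule map on this ideal; the
  -- central element it defines is the ratio of q to p.
  let J : TwoSidedIdeal R := .mk' {w | ∃ z, ∀ s, p * of R s * of R z = q * of R s * of R w}
    ⟨0, fun s => by simp⟩
    (by
      rintro x y ⟨z, hz⟩ ⟨z', hz'⟩
      exact ⟨z + z', fun s => by rw [map_add, map_add, mul_add, mul_add, hz, hz']⟩)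
    (by
      rintro x ⟨z, hz⟩
      exact ⟨-z, fun s => by rw [map_neg, map_neg, mul_neg, mul_neg, hz]⟩)
    (by
      rintro u x ⟨z, hz⟩
      refine ⟨u * z, fun s => ?_⟩
      have := hz (s * u)
      simpa only [map_mul, mul_assoc] using this)
    (by
      rintro x u ⟨z, hz⟩
      refine ⟨z * u, fun s => ?_⟩
      rw [map_mul, map_mul, ← mul_assoc, hz, mul_assoc])
  have hmem : ∀ w, w ∈ J ↔ ∃ z, ∀ s, p * of R s * of R z = q * of R s * of R w := fun w =>
    TwoSidedIdeal.mem_mk' ..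
  have huniq : ∀ z z', (∀ s, p * of R s * of R z = p * of R s * of R z') → z = z' := by
    intro z z' hz
    apply of_injective
    refine sub_eq_zero.mp ((eq_zero_or_eq_zero (p := p) fun s => ?_).resolve_left hp)
    rw [mul_sub, hz, sub_self]
  choose! f hf using fun w => (hmem w).mp
  have hJ : J ≠ ⊥ := by
    obtain ⟨I, hI, hpI⟩ := exists_ideal p
    obtain ⟨I', hI', hqI⟩ := exists_ideal q'
    -- The hypothesis multiplied by y on the right puts py in `J`, with witness q'y.
    obtain ⟨y, hy, hy0⟩ : ∃ y ∈ I ⊓ I', p * of R y ≠ 0 := by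
      by_contra! hh; exact hp (eq_zero_of_mul_of (inf_ne_bot hI hI') hh)
    rw [TwoSidedIdeal.mem_inf] at hy
    obtain ⟨z, hz⟩ := (hpI y hy.1).1
    obtain ⟨z', hz'⟩ := (hqI y hy.2).1
    refine ne_bot_of_mem (x := z) ((hmem z).mpr ⟨z', fun s => ?_⟩) fun h0 => hy0 ?_
    · rw [← hz, ← hz', ← mul_assoc, h, mul_assoc]
    · rw [hz, h0, map_zero]
  obtain ⟨c, hc⟩ := exists_extendedCentroid J hJ f
    (fun x hx y hy => huniq _ _ fun s => by
      rw [hf _ (J.add_mem hx hy), map_add, map_add, mul_add, mul_add, hf x hx, hf y hy])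
    (fun x hx u => huniq _ _ fun s => by
      rw [hf _ (J.mul_mem_right _ _ hx), map_mul, map_mul, ← mul_assoc, ← mul_assoc, hf x hx])
    (fun x hx u => huniq _ _ fun s => by
      have := hf x hx (s * u)
      rw [hf _ (J.mul_mem_left _ _ hx)]
      simp only [map_mul, mul_assoc] at this ⊢
      exact this.symm)
  obtain ⟨w, hw, hw0⟩ := exists_mem_ne_zero hJ
  refine ⟨c, sub_eq_zero.mp ((eq_zero_or_eq_zero (q := of R w) fun s => ?_).resolve_right
    fun h0 => hw0 (of_injective (h0.trans (map_zero _).symm)))⟩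
  have hcc := Subring.mem_center_iff.mp c.2 (p * of R s)
  rw [sub_mul, sub_mul, ← hf w hw, ← hc w hw, ← mul_assoc, hcc, ← mul_assoc, sub_self]

/-- Since c is central, Martindale's lemma applies to the pair c, 1 and makes 1 a multiple of c. -/
theorem exists_mul_eq_one {c : ExtendedCentroid R} (hc : c ≠ 0) : ∃ d, d * c = 1 := by
  obtain ⟨d, hd⟩ := exists_eq_mul (p := (c : MartindaleQuotient R)) (q := 1) (q' := 1)
    (fun h => hc (Subtype.ext h)) fun s => by
      rw [mul_one, one_mul]; exact (Subring.mem_center_iff.mp c.2 _).symm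
  exact ⟨d, Subtype.ext hd.symm⟩

instance : Nontrivial (ExtendedCentroid R) := by
  refine ⟨1, 0, fun h => ?_⟩
  obtain ⟨x, hx⟩ := exists_ne (0 : R)
  refine hx (of_injective ?_)
  rw [map_zero, ← one_mul (of R x), show (1 : MartindaleQuotient R) = 0 from congrArg Subtype.val h,
    zero_mul]

theorem smul_eq_zero_extendedCentroid {c : ExtendedCentroid R} {q : MartindaleQuotient R}
    (h : c • q = 0) : c = 0 ∨ q = 0 := by
  refine or_iff_not_imp_left.mpr fun hc => ?_
  obtain ⟨d, hd⟩ := exists_mul_eq_one hc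
  rw [← one_smul (ExtendedCentroid R) q, ← hd, mul_smul, h, smul_zero]

/-! ### Commutator identities over the extended centroid. -/

theorem lie_smul_right (c : ExtendedCentroid R) (p q : MartindaleQuotient R) :
    p * (c • q) - (c • q) * p = c • (p * q - q * p) := by
  have := Subring.mem_center_iff.mp c.2 p
  simp only [Subring.smul_def, smul_eq_mul]
  rw [mul_sub, ← mul_assoc, this, mul_assoc, mul_assoc]

theorem lie_smul_left (c : ExtendedCentroid R) (p q : MartindaleQuotient R) :
    (c • p) * q - q * (c • p) = c • (p * q - q * p) := by
  rw [← neg_sub, lie_smul_right, ← smul_neg, neg_sub]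

/-- If `ad x ∘ ad y` vanishes on `R` and `x` is not central, then `y` lies in `C x + C`. -/
theorem exists_eq_smul_add {x y : MartindaleQuotient R}
    (hxy : ∀ r, x * (y * of R r - of R r * y) - (y * of R r - of R r * y) * x = 0)
    {r₀ : R} (hx : x * of R r₀ - of R r₀ * x ≠ 0) :
    ∃ c d : ExtendedCentroid R, y = c • x + d • 1 := by
  -- The cross terms of the Leibniz rule for ad x ∘ ad y on the product rs.
  have h1 : ∀ r s, (y * of R r - of R r * y) * (x * of R s - of R s * x) +
      (x * of R r - of R r * x) * (y * of R s - of R s * y) = 0 := by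
    intro r s
    have e := hxy (r * s)
    rw [map_mul] at e
    have e1 := congrArg (· * of R s) (hxy r)
    have e2 := congrArg (of R r * ·) (hxy s)
    simp only [zero_mul, mul_zero] at e1 e2
    calc _ = _ - _ - _ := ?_
      _ = 0 := (congrArg₂ (· - ·) (congrArg₂ (· - ·) e e1) e2).trans (by simp)
    noncomm_ring
  -- Putting st for s inserts a free middle factor, as Martindale's lemma requires.
  have h2 : ∀ r s t, (y * of R r - of R r * y) * of R s * (x * of R t - of R t * x) +
      (x * of R r - of R r * x) * of R s * (y * of R t - of R t * y) = 0 := by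
    intro r s t
    have e1 := h1 r (s * t)
    have e2 := congrArg (· * of R t) (h1 r s)
    simp only [zero_mul, map_mul] at e1 e2
    calc _ = _ - _ := ?_
      _ = 0 := (congrArg₂ (· - ·) e1 e2).trans (sub_zero 0)
    noncomm_ring
  obtain ⟨c, hc⟩ := exists_eq_mul (q := y * of R r₀ - of R r₀ * y)
    (q' := -(y * of R r₀ - of R r₀ * y)) hx fun s => by
      rw [mul_neg]; exact (eq_neg_of_add_eq_zero_left (h2 r₀ s r₀)).symm
  have hcy : y + c • x ∈ ExtendedCentroid R := by
    refine mem_center_of_commute fun t => sub_eq_zero.mp ?_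
    -- With [y, r₀] = c[x, r₀], `h2` becomes [x, r₀] s [y + cx, t] = 0.
    refine (eq_zero_or_eq_zero fun s => ?_).resolve_left hx
    have e := h2 r₀ s t
    rw [hc, add_comm] at e
    have h3 := lie_smul_left c x (of R t)
    have h4 : (y + c • x) * of R t - of R t * (y + c • x) =
      (y * of R t - of R t * y) + c * (x * of R t - of R t * x) := by
      rw [add_mul, mul_add, add_sub_add_comm, h3]; rfl
    rw [h4, mul_add, ← e]
    congr 1
    rw [← mul_assoc, Subring.mem_center_iff.mp c.2, ← mul_assoc]
  refine ⟨-c, ⟨_, hcy⟩, ?_⟩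
  simp [Subring.smul_def]

/-- An element spanning a one-dimensional Lie ideal is central. -/
theorem commute_of_forall_lie_mem_span {a : R}
    (h : ∀ r, ∃ c : ExtendedCentroid R, of R (a * r - r * a) = c • of R a) (r : R) :
    a * r = r * a := by
  by_contra hr
  have ha : a ≠ 0 := by rintro rfl; simp at hr
  have ha' : of R a ≠ 0 := fun h0 => ha (of_injective (h0.trans (map_zero _).symm))
  obtain ⟨c, hc⟩ := h r
  have hc0 : c ≠ 0 := by
    rintro rfl
    rw [zero_smul] at hc
    exact hr (sub_eq_zero.mp (of_injective (hc.trans (map_zero _).symm)))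
  obtain ⟨d, hd⟩ := exists_mul_eq_one hc0
  -- [a, ra] = [a, r]a = ca², and it is also a multiple of a; hence a² is one too.
  obtain ⟨e, he⟩ := h (r * a)
  have hsq : of R (a * a) = (d * e) • of R a := by
    rw [mul_smul, ← he, show a * (r * a) - r * a * a = (a * r - r * a) * a by noncomm_ring,
      map_mul (of R) (a * r - r * a), hc, smul_mul_assoc, smul_smul, hd, one_smul, map_mul]
  generalize d * e = m at hsq
  have hm : m = 0 := by
    -- With a² = ma the two terms of a[a, r]a cancel, whereas [a, r] = ca gives it the value cm²a.
    have h0 : of R (a * (a * r - r * a) * a) = 0 := by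
      rw [show a * (a * r - r * a) * a = a * a * (r * a) - a * r * (a * a) by noncomm_ring,
        map_sub, map_mul (of R) (a * a), hsq, map_mul (of R) (a * r), hsq, smul_mul_assoc,
        mul_smul_comm, ← smul_sub, ← map_mul, ← map_mul, mul_assoc, sub_self, smul_zero]
    rw [map_mul, map_mul, hc, mul_smul_comm, ← map_mul, hsq, smul_mul_assoc, smul_mul_assoc,
      ← map_mul, hsq] at h0
    have h1 := ((smul_eq_zero_extendedCentroid h0).resolve_left hc0)
    rcases smul_eq_zero_extendedCentroid h1 with h2 | h2
    · exact h2
    · exact (smul_eq_zero_extendedCentroid h2).resolve_right ha'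
  rw [hm, zero_smul] at hsq
  -- Now a² = 0, so asa = -a[a, s] is a multiple of a² and vanishes.
  refine ha (or_self_iff.mp (IsPrimeRing.eq_zero_or_eq_zero a a fun s => ?_))
  obtain ⟨k, hk⟩ := h s
  apply of_injective
  rw [map_zero, show a * s * a = a * a * s - a * (a * s - s * a) by noncomm_ring, map_sub, map_mul,
    hsq, map_mul, hk, mul_smul_comm, ← map_mul, hsq, zero_mul, smul_zero, sub_self]

/-! ### Linear independence and rank over the extended centroid. -/

theorem linearIndependent_pair {p q : MartindaleQuotient R} (hp : p ≠ 0)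
    (h : ∀ c : ExtendedCentroid R, q ≠ c • p) :
    LinearIndependent (ExtendedCentroid R) ![p, q] := by
  refine LinearIndependent.pair_iff.mpr fun s t hst => ?_
  have ht : t = 0 := by
    by_contra ht
    obtain ⟨d, hd⟩ := exists_mul_eq_one ht
    refine h (-(d * s)) ?_
    rw [neg_smul, mul_smul, eq_neg_of_add_eq_zero_left hst, smul_neg, neg_neg, smul_smul, hd,
      one_smul]
  rw [ht, zero_smul, add_zero] at hst
  exact ⟨(smul_eq_zero_extendedCentroid hst).resolve_right hp, ht⟩

theorem le_rank_of_linearIndependent {n : ℕ}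
    {S : Submodule (ExtendedCentroid R) (MartindaleQuotient R)} {v : Fin n → MartindaleQuotient R}
    (hv : LinearIndependent (ExtendedCentroid R) v) (hS : ∀ i, v i ∈ S) :
    (n : Cardinal) ≤ Module.rank (ExtendedCentroid R) S := by
  have : LinearIndependent (ExtendedCentroid R) fun i => (⟨v i, hS i⟩ : S) :=
    LinearIndependent.of_comp S.subtype hv
  simpa using this.cardinal_lift_le_rank

theorem exists_eq_of_rank_le_two {S : Submodule (ExtendedCentroid R) (MartindaleQuotient R)}
    {a b x : MartindaleQuotient R} (hab : LinearIndependent (ExtendedCentroid R) ![a, b])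
    (ha : a ∈ S) (hb : b ∈ S) (hx : x ∈ S) (hS : Module.rank (ExtendedCentroid R) S ≤ 2) :
    ∃ c d : ExtendedCentroid R, x = c • a + d • b := by
  by_contra! h
  have hv : LinearIndependent (ExtendedCentroid R) (Fin.cons x ![a, b] : Fin 3 → _) := by
    refine LinearIndependent.finCons' x _ hab ?_
    intro c y hy hcy
    by_contra! hc
    obtain ⟨e, he⟩ := exists_mul_eq_one hc
    rw [Matrix.range_cons, Matrix.range_cons, Matrix.range_empty, Set.union_empty,
      Set.singleton_union, Submodule.mem_span_pair] at hy
    obtain ⟨s, t, rfl⟩ := hy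
    refine h (-(e * s)) (-(e * t)) ?_
    rw [neg_smul, neg_smul, ← neg_add, mul_smul, mul_smul, ← smul_add,
      eq_neg_of_add_eq_zero_right hcy, smul_neg, neg_neg, smul_smul, he, one_smul]
  have h3 := (le_rank_of_linearIndependent (S := S) hv fun i => by
    fin_cases i
    exacts [hx, ha, hb]).trans hS
  norm_num at h3

end MartindaleQuotient

open MartindaleQuotient

/-! ### Lie ideals, their C-span and their centralizers. -/

section LieIdeal

variable {R : Type u} [NonUnitalRing R] [IsPrimeRing R] {K : AddSubgroup R}

theorem of_mem_mulExtendedCentroid {A : Set R} {a : R} (ha : a ∈ A) :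
    of R a ∈ mulExtendedCentroid A :=
  Submodule.subset_span ⟨a, ha, rfl⟩

/-- For k in K each [k, s] is again in K and so commutes with x; thus ad x ∘ ad k kills R and k lies
in Cx + C. -/
theorem IsLieIdeal.rank_le_two (hK : IsLieIdeal K) {x r : R} (hx : ∀ k ∈ K, k * x = x * k)
    (hr : x * r ≠ r * x) :
    Module.rank (ExtendedCentroid R) (mulExtendedCentroid (K : Set R)) ≤ 2 := by
  have hle : mulExtendedCentroid (K : Set R) ≤ Submodule.span (ExtendedCentroid R) {of R x, 1} := by
    refine Submodule.span_le.mpr ?_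
    rintro _ ⟨k, hk, rfl⟩
    obtain ⟨c, d, h⟩ := exists_eq_smul_add (x := of R x) (y := of R k) (r₀ := r)
      (fun r => by
        rw [← map_mul, ← map_mul, ← map_sub, ← map_mul, ← map_mul, ← map_sub,
          hx _ (hK k hk r), sub_self, map_zero])
      (fun h0 => by
        rw [← map_mul, ← map_mul] at h0
        exact hr (of_injective (sub_eq_zero.mp h0)))
    exact Submodule.mem_span_pair.mpr ⟨c, d, h.symm⟩
  refine (Submodule.rank_mono hle).trans ((rank_span_le _).trans ?_)
  refine (Cardinal.mk_insert_le).trans ?_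
  rw [Cardinal.mk_singleton, one_add_one_eq_two]

theorem IsLieIdeal.exists_linearIndependent (hK : IsLieIdeal K) {a r : R} (ha : a ∈ K)
    (hr : a * r ≠ r * a) :
    ∃ b ∈ K, LinearIndependent (ExtendedCentroid R) ![of R a, of R b] := by
  by_contra! h
  refine hr (commute_of_forall_lie_mem_span (fun s => ?_) r)
  by_contra! hs
  refine h _ (hK a ha s) (linearIndependent_pair (fun h0 => hr ?_) hs)
  rw [of_injective (h0.trans (map_zero _).symm), zero_mul, mul_zero]

theorem IsLieIdeal.two_le_rank (hK : IsLieIdeal K) {a r : R} (ha : a ∈ K)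
    (hr : a * r ≠ r * a) :
    2 ≤ Module.rank (ExtendedCentroid R) (mulExtendedCentroid (K : Set R)) := by
  obtain ⟨b, hb, hab⟩ := hK.exists_linearIndependent ha hr
  exact_mod_cast le_rank_of_linearIndependent hab fun i => by
    fin_cases i
    exacts [of_mem_mulExtendedCentroid ha, of_mem_mulExtendedCentroid hb]

/-- Put u = [a, b]. Expanding [u, r] = [a, [b, r]] + [[a, r], b] in the basis a, b of KC gives a
multiple of u, so u is central. As u itself lies in K, it is ca + db; commuting with b and with a
forces c[a, b] = 0 and d[a, b] = 0, so u = 0. -/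
theorem IsLieIdeal.commute_of_linearIndependent (hK : IsLieIdeal K)
    (hrank : Module.rank (ExtendedCentroid R) (mulExtendedCentroid (K : Set R)) ≤ 2)
    {a b : R} (ha : a ∈ K) (hb : b ∈ K)
    (hab : LinearIndependent (ExtendedCentroid R) ![of R a, of R b]) : a * b = b * a := by
  have hspan : ∀ x ∈ K, ∃ c d : ExtendedCentroid R, of R x = c • of R a + d • of R b := fun x hx =>
    exists_eq_of_rank_le_two hab (of_mem_mulExtendedCentroid ha) (of_mem_mulExtendedCentroid hb)
      (of_mem_mulExtendedCentroid hx) hrank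
  have hcomm := commute_of_forall_lie_mem_span (a := a * b - b * a) fun r => by
    obtain ⟨c, d, h⟩ := hspan _ (hK b hb r)
    obtain ⟨c', d', h'⟩ := hspan _ (hK a ha r)
    refine ⟨d + c', ?_⟩
    rw [show (a * b - b * a) * r - r * (a * b - b * a) =
      (a * (b * r - r * b) - (b * r - r * b) * a) +
        ((a * r - r * a) * b - b * (a * r - r * a)) by noncomm_ring]
    rw [map_add, map_sub, map_sub, map_mul, map_mul, map_mul, map_mul, h, h', map_sub, map_mul,
      map_mul]
    simp only [mul_add, add_mul, add_smul]
    rw [add_sub_add_comm, add_sub_add_comm, lie_smul_right, lie_smul_right, lie_smul_left,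
      lie_smul_left, sub_self, sub_self, smul_zero, smul_zero, zero_add, add_zero]
  obtain ⟨c, d, h⟩ := hspan _ (hK a ha b)
  by_contra hne
  have hne' : of R a * of R b - of R b * of R a ≠ 0 := fun h0 => by
    rw [← map_mul, ← map_mul] at h0
    exact hne (of_injective (sub_eq_zero.mp h0))
  have hc : c = 0 := by
    have e := congrArg (of R) (hcomm b)
    rw [map_mul, map_mul, h, add_mul, mul_add, ← sub_eq_zero, add_sub_add_comm, lie_smul_left,
      lie_smul_left, sub_self, smul_zero, add_zero] at e
    exact (smul_eq_zero_extendedCentroid e).resolve_right hne'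
  have hd : d = 0 := by
    have e := congrArg (of R) (hcomm a)
    rw [map_mul, map_mul, h, add_mul, mul_add, eq_comm, ← sub_eq_zero, add_sub_add_comm,
      lie_smul_right, lie_smul_right, sub_self, smul_zero, zero_add] at e
    exact (smul_eq_zero_extendedCentroid e).resolve_right hne'
  rw [hc, hd, zero_smul, zero_smul, zero_add] at h
  exact hne (sub_eq_zero.mp (of_injective (h.trans (map_zero _).symm)))

/-- A Lie ideal `K` with `dim_C KC = 2` is commutative. -/
theorem IsLieIdeal.commute_of_rank (hK : IsLieIdeal K)
    (hrank : Module.rank (ExtendedCentroid R) (mulExtendedCentroid (K : Set R)) ≤ 2)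
    {a b : R} (ha : a ∈ K) (hb : b ∈ K) : a * b = b * a := by
  by_contra hne
  refine hne (hK.commute_of_linearIndependent hrank ha hb
    (linearIndependent_pair (fun h0 => hne ?_) fun c hc => hne ?_))
  · rw [of_injective (h0.trans (map_zero _).symm), zero_mul, mul_zero]
  · apply of_injective
    rw [map_mul, map_mul, hc, ← sub_eq_zero, lie_smul_right, sub_self, smul_zero]

/-- If `a ∈ K` is not central, then the centralizer of `K` lies in `C a + C`. -/
theorem IsLieIdeal.exists_eq_smul_add_of_centralizes (hK : IsLieIdeal K) {a r : R} (ha : a ∈ K)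
    (hr : a * r ≠ r * a) {x : MartindaleQuotient R} (hx : ∀ k ∈ K, of R k * x = x * of R k) :
    ∃ c d : ExtendedCentroid R, x = c • of R a + d • 1 := by
  refine exists_eq_smul_add (r₀ := r) (fun s => ?_) fun h0 => ?_
  · have e1 := sub_eq_zero.mpr (hx _ (hK a ha s))
    have e2 := sub_eq_zero.mpr (hx a ha)
    rw [map_sub, map_mul, map_mul] at e1
    -- Jacobi identity: [a, [x, s]] = [[a, x], s] - [[a, s], x], where x commutes with both a and
    -- [a, s].
    calc _ = (of R a * x - x * of R a) * of R s - of R s * (of R a * x - x * of R a) -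
        ((of R a * of R s - of R s * of R a) * x - x * (of R a * of R s - of R s * of R a)) := by
          noncomm_ring
      _ = 0 := by rw [e1, e2, zero_mul, mul_zero, sub_zero, sub_zero]
  · rw [← map_mul, ← map_mul] at h0
    exact hr (of_injective (sub_eq_zero.mp h0))

/-- K is commutative, so an independent b in K centralizes K and equals ca + d; independence gives d
≠ 0, and the equation is solved for 1. -/
theorem IsLieIdeal.one_mem (hK : IsLieIdeal K)
    (hrank : Module.rank (ExtendedCentroid R) (mulExtendedCentroid (K : Set R)) ≤ 2)
    {a r : R} (ha : a ∈ K) (hr : a * r ≠ r * a) :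
    (1 : MartindaleQuotient R) ∈ mulExtendedCentroid (K : Set R) := by
  obtain ⟨b, hb, hab⟩ := hK.exists_linearIndependent ha hr
  obtain ⟨c, d, h⟩ := hK.exists_eq_smul_add_of_centralizes ha hr (x := of R b) fun k hk => by
    rw [← map_mul, ← map_mul, hK.commute_of_rank hrank hk hb]
  have hd : d ≠ 0 := by
    rintro rfl
    rw [zero_smul, add_zero] at h
    have e := (LinearIndependent.pair_iff.mp hab c (-1) (by rw [h, neg_smul, one_smul, add_neg_cancel])).2
    exact one_ne_zero (neg_eq_zero.mp e)
  obtain ⟨e, he⟩ := exists_mul_eq_one hd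
  have h1 : (1 : MartindaleQuotient R) = e • (of R b - c • of R a) := by
    rw [h, add_sub_cancel_left, smul_smul, he, one_smul]
  rw [h1]
  exact Submodule.smul_mem _ _ (Submodule.sub_mem _ (of_mem_mulExtendedCentroid hb)
    (Submodule.smul_mem _ _ (of_mem_mulExtendedCentroid ha)))

theorem mulExtendedCentroid_subset_centralizer
    (h : ∀ a ∈ K, ∀ b ∈ K, a * b = b * a) :
    (mulExtendedCentroid (K : Set R) : Set (MartindaleQuotient R)) ⊆
      Set.centralizer (of R '' (K : Set R)) := by
  rintro x hx _ ⟨k, hk, rfl⟩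
  refine Submodule.span_induction (p := fun x _ => of R k * x = x * of R k) ?_ ?_ ?_ ?_ hx
  · rintro _ ⟨l, hl, rfl⟩
    rw [← map_mul, ← map_mul, h k hk l hl]
  · rw [mul_zero, zero_mul]
  · intro x y _ _ hx hy
    rw [mul_add, add_mul, hx, hy]
  · intro c x _ hx
    rw [← sub_eq_zero, lie_smul_right, hx, sub_self, smul_zero]

/-- Equality makes the noncentral a centralize K, which bounds the rank by 2. Conversely, rank 2
makes K commutative and puts Ca + C, which contains the centralizer, inside KC. -/
theorem IsLieIdeal.centralizer_eq_iff (hK : IsLieIdeal K) {a r : R} (ha : a ∈ K)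
    (hr : a * r ≠ r * a) :
    (mulExtendedCentroid (Set.univ : Set R) : Set (MartindaleQuotient R)) ∩
          Set.centralizer (of R '' (K : Set R)) =
        (mulExtendedCentroid (K : Set R) : Set (MartindaleQuotient R)) ↔
      Module.rank (ExtendedCentroid R) (mulExtendedCentroid (K : Set R)) = 2 := by
  constructor
  · intro h
    refine le_antisymm (hK.rank_le_two (x := a) (fun k hk => ?_) hr) (hK.two_le_rank ha hr)
    have hmem : of R a ∈ Set.centralizer (of R '' (K : Set R)) :=
      (h.ge (of_mem_mulExtendedCentroid ha)).2
    have e := hmem (of R k) ⟨k, hk, rfl⟩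
    rw [← map_mul, ← map_mul] at e
    exact of_injective e
  · intro h
    refine subset_antisymm ?_ (Set.subset_inter ?_ ?_)
    · rintro x ⟨-, hx⟩
      obtain ⟨c, d, rfl⟩ := hK.exists_eq_smul_add_of_centralizes ha hr fun k hk =>
        hx _ ⟨k, hk, rfl⟩
      exact Submodule.add_mem _ (Submodule.smul_mem _ _ (of_mem_mulExtendedCentroid ha))
        (Submodule.smul_mem _ _ (hK.one_mem h.le ha hr))
    · exact Submodule.span_mono (Set.image_mono (Set.subset_univ _))
    · exact mulExtendedCentroid_subset_centralizer fun x hx y hy => hK.commute_of_rank h.le hx hy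

/-- In rank at most 2 commutativity of K makes a itself a noncentral centralizing element; in larger
rank `IsLieIdeal.rank_le_two` excludes such elements. -/
theorem IsLieIdeal.centralizer_eq_center_iff (hK : IsLieIdeal K) {a r : R} (ha : a ∈ K)
    (hr : a * r ≠ r * a) :
    Set.centralizer (K : Set R) = Set.center R ↔
      2 < Module.rank (ExtendedCentroid R) (mulExtendedCentroid (K : Set R)) := by
  constructor
  · intro h
    by_contra! hrank
    have hmem : a ∈ Set.centralizer (K : Set R) := fun k hk => hK.commute_of_rank hrank hk ha
    rw [h] at hmem
    exact hr (Semigroup.mem_center_iff.mp hmem r).symm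
  · intro h
    refine subset_antisymm (fun x hx => Semigroup.mem_center_iff.mpr fun s => ?_)
      (Set.center_subset_centralizer _)
    by_contra hs
    exact h.not_ge (hK.rank_le_two hx (Ne.symm hs))

end LieIdeal

/-- Here `mulExtendedCentroid Set.univ` is the central closure `RC`, and elements of `R` are viewed
in `RC` through the canonical embedding `R → Q_s(R)`. -/
theorem mainTheorem9 {R : Type u} [NonUnitalRing R] [IsPrimeRing R] (K : AddSubgroup R)
    (hK : IsLieIdeal K) (hnc : ¬ (K : Set R) ⊆ Set.center R) :
    ((mulExtendedCentroid (Set.univ : Set R) : Set (MartindaleQuotient R)) ∩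
          Set.centralizer (MartindaleQuotient.of R '' (K : Set R)) =
        (mulExtendedCentroid (K : Set R) : Set (MartindaleQuotient R)) ↔
      Module.rank (ExtendedCentroid R) (mulExtendedCentroid (K : Set R)) = 2) ∧
    (Set.centralizer (K : Set R) = Set.center R ↔
      2 < Module.rank (ExtendedCentroid R) (mulExtendedCentroid (K : Set R))) := by
  obtain ⟨a, ha, hac⟩ := Set.not_subset.mp hnc
  obtain ⟨r, hr⟩ : ∃ r, a * r ≠ r * a := by
    by_contra! h
    exact hac (Semigroup.mem_center_iff.mpr fun r => (h r).symm)
  exact ⟨hK.centralizer_eq_iff ha hr, hK.centralizer_eq_center_iff ha hr⟩
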